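/- Let $P=\{p_1,\dots,p_m\}$ be a finite poset, enumerated so that $p_i<p_j$ implies $i<j$. Let $n\ge 1$, and let $\mathcal A$ assign to each $p_i\in P$ a non-empty subset $A_i=\mathcal A_{p_i}$ of $[n]=\{1,\dots,n\}$. Let $\mathrm{Hom}(P,\mathcal A)$ be the set of isotone maps $f:P\to[n]$ with $f(p)\in\mathcal A_p$ for all $p\in P$, ordered pointwise, and let $\mathfrak A\subseteq \mathrm{Hom}(P,\mathcal A)$ be a poset ideal, that is, a non-empty down-closed subset. Let $\mathbf K$ be a field, $R=\mathbf K[X_{p,a}\mid p\in P,\ a\in[n]]$ with its $\mathbb Z^{P\times[n]}$-grading and $\mathfrak m$ the ideal generated by the variables. Let $$\mathcal L(\mathfrak A)=\Big(\prod_{p\in P}X_{p,f(p)}\ \Big|\ f\in\mathfrak A\Big)\subseteq R$$ be the associated generalized co-letterplace ideal. For $K\subseteq[n]$ put $X_{p,K}=\prod_{a\in K}X_{p,a}$. For $t\ge0$ let $F_t$ be the free $R$-module whose basis consists of the symbols $[K_1,\dots,K_m]$, of multidegree $X_{p_1,K_1}\cdots X_{p_m,K_m}$, such that 1. $\emptyset\ne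 K_i\subseteq A_i$ for all $i$; 2. $|K_1|+\dots+|K_m|=m+t$; 3. $\max K_i\le\min K_j$ whenever $p_i<p_j$; 4. the map $p_i\mapsto \max K_i$ belongs to $\mathfrak A$. Define $d_0:F_0\to\mathcal L(\mathfrak A)$ by $d_0([K_1,\dots,K_m])=X_{p_1,K_1}\cdots X_{p_m,K_m}$. For $t\ge1$ and a basis symbol $[K_1,\dots,K_m]$ of $F_t$, put $\Omega=\{X_{p_i,a}\mid 1\le i\le m,\ |K_i|\ge2,\ a\in K_i\}$ and $\overline\Omega=\{X_{p_i,a}\mid 1\le i\le m,\ a\in K_i\}$. Order $\overline\Omega$ by $X_{p_i,a}>X_{p_j,b}$ if and only if $i<j$, or $i=j$ and $a<b$, and let $\sigma(X_{p_i,a},\overline\Omega)$ be the number of elements of $\overline\Omega$ larger than $X_{p_i,a}$. Define $d_t:F_t\to F_{t-1}$ by $$d_t([K_1,\dots,K_m])=\sum_{X_{p_i,a}\in\Omega}(-1)^{\sigma(X_{p_i,a},\overline\Omega)}X_{p_i,a}\,[K_1,\dots,K_i\setminus\{a\},\dots,K_m].$$ Theorem. The largest $t$ for which $F_t$ has a basis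 symbol exists; call it $p$. The sequence $$0\to F_p\xrightarrow{d_p}F_{p-1}\to\cdots\xrightarrow{d_1}F_0\xrightarrow{d_0}\mathcal L(\mathfrak A)\to0$$ is a minimal multigraded free resolution of $\mathcal L(\mathfrak A)$: the modules $F_t$ are finitely generated, the sequence is exact, all maps preserve multidegrees, and $d_t(F_t)\subseteq\mathfrak m F_{t-1}$ for all $t\ge1$. Moreover, $p$ is the projective dimension of the $R$-module $\mathcal L(\mathfrak A)$. -/

import Mathlib

/-! ### Multigraded free resolutions over a polynomial ring -/

section Resolutions

open MvPolynomial

/-- An augmented sequence of based, multigraded free modules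
`⋯ → F₂ → F₁ → F₀ → I` over the polynomial ring `𝕜[X_v : v ∈ σ]`, where `I` is an ideal.
The module `F_t` is free with basis `basis t`, and `deg t b` is the multidegree
(an exponent vector) of the basis element `b`. -/
structure BasedSequence (𝕜 : Type*) [Field 𝕜] (σ : Type*) (I : Ideal (MvPolynomial σ 𝕜)) where
  /-- the basis of `F_t` -/
  basis : ℕ → Type*
  /-- the multidegrees of the basis elements -/
  deg : ∀ t, basis t → (σ →₀ ℕ)
  /-- the map `d_{t+1} : F_{t+1} → F_t` -/
  d : ∀ t, (basis (t + 1) →₀ MvPolynomial σ 𝕜) →ₗ[MvPolynomial σ 𝕜]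
    (basis t →₀ MvPolynomial σ 𝕜)
  /-- the augmentation `d_0 : F_0 → I` -/
  aug : (basis 0 →₀ MvPolynomial σ 𝕜) →ₗ[MvPolynomial σ 𝕜] I

namespace BasedSequence

variable {𝕜 : Type*} [Field 𝕜] {σ : Type*} {I : Ideal (MvPolynomial σ 𝕜)}

/-- `x ∈ F_t` is homogeneous of multidegree `u`: every term `c X^v b` occurring in `x`
(with `c ≠ 0` in `𝕜` and `b` a basis element) satisfies `v + deg b = u`. -/
def IsHomogeneousElt (F : BasedSequence 𝕜 σ I) (t : ℕ) (u : σ →₀ ℕ)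
    (x : F.basis t →₀ MvPolynomial σ 𝕜) : Prop :=
  ∀ b : F.basis t, ∀ v ∈ (x b).support, v + F.deg t b = u

/-- `F` is a multigraded free resolution of `I` (of finite length, by finitely generated
free modules): it is exact, and all maps preserve multidegrees. -/
structure IsMultigradedFreeResolution (F : BasedSequence 𝕜 σ I) : Prop where
  finite : ∀ t, Finite (F.basis t)
  bounded : ∃ p, ∀ t, p < t → IsEmpty (F.basis t)
  aug_surjective : Function.Surjective F.aug
  exact_zero : Function.Exact (F.d 0) F.aug
  exact_succ : ∀ t, Function.Exact (F.d (t + 1)) (F.d t)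
  d_homogeneous : ∀ t u x, F.IsHomogeneousElt (t + 1) u x → F.IsHomogeneousElt t u (F.d t x)
  aug_homogeneous : ∀ u x, F.IsHomogeneousElt 0 u x →
    ∀ v ∈ (F.aug x : MvPolynomial σ 𝕜).support, v = u

/-- `F` is minimal: `d_{t+1}(F_{t+1}) ⊆ 𝔪 F_t` for all `t ≥ 0`, where `𝔪` is the ideal generated
by the variables. -/
def IsMinimal (F : BasedSequence 𝕜 σ I) : Prop :=
  ∀ t, LinearMap.range (F.d t) ≤
    Ideal.span (Set.range (X : σ → MvPolynomial σ 𝕜)) •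
      (⊤ : Submodule (MvPolynomial σ 𝕜) (F.basis t →₀ MvPolynomial σ 𝕜))

end BasedSequence

end Resolutions

/-! ### Generalized co-letterplace ideals -/

namespace CoLetterplace

open MvPolynomial

/-- `Hom(P, 𝒜)`: the isotone maps `f : P → [n]` with `f(p) ∈ 𝒜_p` for all `p`, ordered pointwise.
Here `[n]` is modelled by `Fin n`. -/
abbrev HomSet {P : Type*} [PartialOrder P] {n : ℕ} (A : P → Finset (Fin n)) : Type _ :=
  {f : P → Fin n // Monotone f ∧ ∀ p, f p ∈ A p}

/-- The family obtained from `K` by replacing `K_p` with `K_p ∖ {a}`, where `v = (p, a)`. -/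
def remove {P : Type*} [DecidableEq P] {n : ℕ} (K : P → Finset (Fin n)) (v : P × Fin n) : P → Finset (Fin n) :=
  Function.update K v.1 ((K v.1).erase v.2)

theorem remove_subset {P : Type*} [DecidableEq P] {n : ℕ} (K : P → Finset (Fin n))
    (v : P × Fin n) (p : P) :
    remove K v p ⊆ K p := by
  by_cases h : p = v.1
  · subst h
    simp [remove, Finset.erase_subset]
  · simp [remove, h]

variable {P : Type*} [PartialOrder P] [Fintype P] {n : ℕ} {A : P → Finset (Fin n)}

/-- The monomial `U_f = ∏_{p ∈ P} X_{p, f(p)}`. -/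
noncomputable def monomialU (𝕜 : Type*) [Field 𝕜] (f : P → Fin n) :
    MvPolynomial (P × Fin n) 𝕜 :=
  ∏ p, X (p, f p)

/-- The generalized co-letterplace ideal `ℒ(𝔄) = (U_f : f ∈ 𝔄)`. -/
noncomputable def ideal (𝕜 : Type*) [Field 𝕜] (𝔄 : LowerSet (HomSet A)) :
    Ideal (MvPolynomial (P × Fin n) 𝕜) :=
  Ideal.span {u | ∃ f ∈ 𝔄, u = monomialU 𝕜 f.1}

/-- The conditions on a family `K = (K_p)_{p ∈ P}` of subsets of `[n]` for `[K]` to be a basis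
symbol in homological degree `t`. -/
structure IsSymbol (𝔄 : LowerSet (HomSet A)) (t : ℕ) (K : P → Finset (Fin n)) : Prop where
  nonempty : ∀ p, (K p).Nonempty
  subset : ∀ p, K p ⊆ A p
  card : ∑ p, (K p).card = Fintype.card P + t
  max_le_min : ∀ p q, p < q → (K p).max' (nonempty p) ≤ (K q).min' (nonempty q)
  max_mem : ∃ f ∈ 𝔄, ∀ p, f.1 p = (K p).max' (nonempty p)

/-- The set of basis symbols `[K]` in homological degree `t`. -/
abbrev Symbol (𝔄 : LowerSet (HomSet A)) (t : ℕ) : Type _ :=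
  {K : P → Finset (Fin n) // IsSymbol 𝔄 t K}

/-- `Ω̄(K) = {X_{p,a} : a ∈ K_p}`, as a set of indices `(p, a)`. -/
def OmegaBar (K : P → Finset (Fin n)) : Finset (P × Fin n) :=
  Finset.univ.filter fun v => v.2 ∈ K v.1

/-- `Ω(K) = {X_{p,a} : |K_p| ≥ 2, a ∈ K_p}`, as a set of indices `(p, a)`. -/
def Omega (K : P → Finset (Fin n)) : Finset (P × Fin n) :=
  Finset.univ.filter fun v => 2 ≤ (K v.1).card ∧ v.2 ∈ K v.1

/-- Let `P = {p_1, …, p_m}` be enumerated by `e`. The number of variables in `Ω̄(K)` that are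
larger than `X_v`, where `X_{p_i,a} > X_{p_j,b}` iff `i < j`, or `i = j` and `a < b`. -/
def sigma {m : ℕ} (e : Fin m ≃ P) (K : P → Finset (Fin n)) (v : P × Fin n) : ℕ :=
  ((OmegaBar K).filter fun w =>
    e.symm w.1 < e.symm v.1 ∨ (e.symm w.1 = e.symm v.1 ∧ w.2 < v.2)).card

theorem isSymbol_remove [DecidableEq P] {𝔄 : LowerSet (HomSet A)} {t : ℕ}
    {K : P → Finset (Fin n)} (hK : IsSymbol 𝔄 (t + 1) K) {v : P × Fin n} (hv : v ∈ Omega K) :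
    IsSymbol 𝔄 t (remove K v) := by
  obtain ⟨h2, hmem⟩ : 2 ≤ (K v.1).card ∧ v.2 ∈ K v.1 := by simpa [Omega] using hv
  have hne : ∀ p, (remove K v p).Nonempty := by
    intro p
    by_cases h : p = v.1
    · subst h
      rw [← Finset.card_pos]
      simp only [remove, Function.update_self, Finset.card_erase_of_mem hmem]
      omega
    · simpa [remove, h] using hK.nonempty p
  have hle : ∀ p q, p < q → (remove K v p).max' (hne p) ≤ (remove K v q).min' (hne q) := by
    intro p q hpq
    exact ((Finset.max'_subset (hne p) (remove_subset K v p)).trans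
      (hK.max_le_min p q hpq)).trans (Finset.min'_subset (hne q) (remove_subset K v q))
  refine ⟨hne, fun p => (remove_subset K v p).trans (hK.subset p), ?_, hle, ?_⟩
  · have h1 := hK.card
    rw [← Finset.add_sum_erase _ _ (Finset.mem_univ v.1)] at h1 ⊢
    have h3 : ∑ p ∈ Finset.univ.erase v.1, (remove K v p).card
        = ∑ p ∈ Finset.univ.erase v.1, (K p).card := by
      refine Finset.sum_congr rfl fun p hp => ?_
      simp [remove, Finset.ne_of_mem_erase hp]
    rw [h3]
    simp only [remove, Function.update_self, Finset.card_erase_of_mem hmem]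
    omega
  · obtain ⟨f, hf, hfK⟩ := hK.max_mem
    refine ⟨⟨fun p => (remove K v p).max' (hne p), ?_, fun p =>
      hK.subset p (remove_subset K v p (Finset.max'_mem _ _))⟩, ?_, fun p => rfl⟩
    · intro p q hpq
      rcases hpq.eq_or_lt with rfl | hlt
      · exact le_rfl
      · exact (hle p q hlt).trans (Finset.min'_le_max' _ _)
    · refine 𝔄.lower (fun p => ?_) hf
      rw [hfK p]
      exact Finset.max'_subset (hne p) (remove_subset K v p)

/-- The symbol obtained from `[K]` by removing `a` from `K_p`, where `v = (p, a) ∈ Ω(K)`. -/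
def Symbol.remove [DecidableEq P] {𝔄 : LowerSet (HomSet A)} {t : ℕ} (K : Symbol 𝔄 (t + 1))
    (v : P × Fin n) (hv : v ∈ Omega K.1) : Symbol 𝔄 t :=
  ⟨CoLetterplace.remove K.1 v, isSymbol_remove K.2 hv⟩

/-- The monomial `X_{p_1,K_1} ⋯ X_{p_m,K_m}`, where `X_{p,K} = ∏_{a ∈ K} X_{p,a}`. -/
noncomputable def monomialK (𝕜 : Type*) [Field 𝕜] (K : P → Finset (Fin n)) :
    MvPolynomial (P × Fin n) 𝕜 :=
  ∏ p, ∏ a ∈ K p, X (p, a)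

/-- The multidegree of `[K]`: the exponent vector of the monomial `X_{p_1,K_1} ⋯ X_{p_m,K_m}`. -/
noncomputable def multidegree (K : P → Finset (Fin n)) : (P × Fin n) →₀ ℕ :=
  ∑ p, ∑ a ∈ K p, Finsupp.single (p, a) 1

theorem monomialK_mem (𝕜 : Type*) [Field 𝕜] {𝔄 : LowerSet (HomSet A)} (K : Symbol 𝔄 0) :
    monomialK 𝕜 K.1 ∈ ideal 𝕜 𝔄 := by
  obtain ⟨f, hf, hfK⟩ := K.2.max_mem
  have hcard : ∀ p, (K.1 p).card = 1 := by
    have hsum : ∑ p : P, 1 = ∑ p, (K.1 p).card := by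
      rw [K.2.card]
      simp
    have h := (Finset.sum_eq_sum_iff_of_le
      (fun p _ => Finset.card_pos.2 (K.2.nonempty p))).1 hsum
    exact fun p => (h p (Finset.mem_univ p)).symm
  refine Ideal.subset_span ⟨f, hf, Finset.prod_congr rfl fun p _ => ?_⟩
  obtain ⟨a, ha⟩ := Finset.card_eq_one.1 (hcard p)
  have h1 : f.1 p = a := by
    have hmem : f.1 p ∈ K.1 p := by
      rw [hfK p]
      exact Finset.max'_mem _ _
    rw [ha] at hmem
    simpa using hmem
  rw [ha, h1, Finset.prod_singleton]

/-- The sequence `⋯ → F_1 → F_0 → ℒ(𝔄)`: the module `F_t` is free on the symbols `[K]` of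
homological degree `t`, `d_0([K]) = X_{p_1,K_1} ⋯ X_{p_m,K_m}`, and for `t ≥ 1`
`d_t([K_1,…,K_m]) = ∑_{X_{p_i,a} ∈ Ω} (-1)^{σ(X_{p_i,a}, Ω̄)} X_{p_i,a} [K_1,…,K_i ∖ {a},…,K_m]`. -/
noncomputable def resolution (𝕜 : Type*) [Field 𝕜] [DecidableEq P] {m : ℕ} (e : Fin m ≃ P)
    (𝔄 : LowerSet (HomSet A)) : BasedSequence 𝕜 (P × Fin n) (ideal 𝕜 𝔄) where
  basis t := Symbol 𝔄 t
  deg _ K := multidegree K.1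
  d _ := Finsupp.linearCombination _ fun K =>
    ∑ v ∈ (Omega K.1).attach,
      Finsupp.single (K.remove v.1 v.2) ((-1) ^ sigma e K.1 v.1 * X v.1)
  aug := Finsupp.linearCombination _ fun K => ⟨monomialK 𝕜 K.1, monomialK_mem 𝕜 K⟩

end CoLetterplace

/-! Exactness comes from a matching on the terms X^w [K] of a fixed multidegree u, grouped by the
isotone map f = (p ↦ max K_p). If some (p, a) satisfies a ∈ A_p, X_{p,a} ∣ X^u, a < f(p) and f(q) ≤
a for all q < p, then one such element is fixed as the `pivot`. It depends on (u, f) only, and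
inserting it into K or deleting it from K leaves f unchanged. A term is collapsed if there is no
pivot or the pivot lies in K.

Inserting the pivot rewrites a non-collapsed term, modulo boundaries, through collapsed terms and
terms with smaller f; hence every chain is collapsed modulo boundaries (`exists_sub_mem_collapsed`).
Deleting the pivot shows that the differential is injective on collapsed chains
(`eq_zero_of_diff_eq_zero`). In degree zero a collapsed term has the least f possible in its
multidegree, so the augmentation is injective there too (`eq_zero_of_augm_eq_zero`). With d ∘ d = 0,
every cycle is a boundary.

Minimality is visible from the coefficients ± X_v. It prevents the last nonzero differential from
splitting, so by dimension shifting the length of the resolution is the projective dimension. -/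

/-! ### Projective dimension from a minimal free resolution -/

section ProjectiveDimension

open CategoryTheory

universe u

variable {R : Type u} [CommRing R] {M : Type u} [AddCommGroup M] [Module R M]
  {F : ℕ → Type u} [∀ t, AddCommGroup (F t)] [∀ t, Module R (F t)]
  {d : ∀ t, F (t + 1) →ₗ[R] F t} {aug : F 0 →ₗ[R] M}

/-- The `k`-th syzygy module `W` of a resolution of `M` by projective modules is a quotient of
`F k`, and its projective dimension is that of `M` lowered by `k`. -/
theorem exists_syzygy [∀ t, Module.Projective R (F t)]
    (haug : Function.Surjective aug) (h0 : Function.Exact (d 0) aug)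
    (hd : ∀ t, Function.Exact (d (t + 1)) (d t)) (k : ℕ) :
    ∃ (W : ModuleCat.{u} R) (g : F k →ₗ[R] W), Function.Surjective g ∧
      LinearMap.ker g = LinearMap.range (d k) ∧
      ∀ j, HasProjectiveDimensionLT (ModuleCat.of R M) (k + j + 1) ↔
        HasProjectiveDimensionLT W (j + 1) := by
  induction k with
  | zero =>
    exact ⟨ModuleCat.of R M, aug, haug, LinearMap.exact_iff.1 h0, fun j => by rw [zero_add]⟩
  | succ k ih =>
    obtain ⟨W, g, hg, hker, hW⟩ := ih
    have hmem : ∀ x, d k x ∈ LinearMap.ker g := fun x => hker ▸ LinearMap.mem_range_self _ x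
    refine ⟨ModuleCat.of R (LinearMap.ker g), (d k).codRestrict _ hmem, ?_, ?_, fun j => ?_⟩
    · rintro ⟨y, hy⟩
      rw [hker] at hy
      obtain ⟨x, rfl⟩ := hy
      exact ⟨x, rfl⟩
    · rw [LinearMap.ker_codRestrict]
      exact LinearMap.exact_iff.1 (hd k)
    -- In 0 → ker g → F_k → W → 0 the middle term is projective, so passing to the kernel lowers the
    -- dimension by one.
    · have hS := LinearMap.shortExact_shortComplexKer hg
      have hP : Projective (ModuleCat.of R (F k)) := inferInstance
      rw [show k + 1 + j + 1 = k + (j + 1) + 1 by ring, hW (j + 1)]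
      exact hS.hasProjectiveDimensionLT_X₃_iff j hP

/-- If `F` is a finite resolution of `M` by projective modules which has length `p`, and
`d_p` does not split, then `M` has projective dimension `p`. -/
theorem projectiveDimension_eq_of_resolution [∀ t, Module.Projective R (F t)]
    (haug : Function.Surjective aug) (h0 : Function.Exact (d 0) aug)
    (hd : ∀ t, Function.Exact (d (t + 1)) (d t)) (p : ℕ) (hp : Subsingleton (F (p + 1)))
    (hM : Nontrivial M)
    (hsplit : ∀ k, p = k + 1 → ∀ r : F k →ₗ[R] F (k + 1), r ∘ₗ d k ≠ LinearMap.id) :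
    projectiveDimension (ModuleCat.of R M) = (p : ℕ∞) := by
  apply le_antisymm
  · refine (projectiveDimension_le_iff _ p).2 ?_
    obtain ⟨W, g, hg, hker, hW⟩ := exists_syzygy haug h0 hd p
    refine (hW 0).2 ?_
    -- Since F_{p+1} = 0, the kernel of g vanishes and the p-th syzygy is F_p itself.
    have hinj : Function.Injective g := by
      rw [← LinearMap.ker_eq_bot, hker, LinearMap.range_eq_bot]
      ext x
      rw [Subsingleton.elim x 0, map_zero, map_zero]
    have : Module.Projective R W := Module.Projective.of_equiv (LinearEquiv.ofBijective g ⟨hinj, hg⟩)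
    have hP : Projective W := (IsProjective.iff_projective (R := R) W).1 this
    exact projective_iff_hasProjectiveDimensionLT_one.1 hP
  · refine (projectiveDimension_ge_iff _ p).2 fun h => ?_
    obtain _ | k := p
    · have h1 := (hasProjectiveDimensionLT_zero_iff_isZero _).1 h
      have := ModuleCat.subsingleton_of_isZero h1
      exact not_subsingleton M this
    · obtain ⟨W, g, hg, hker, hW⟩ := exists_syzygy haug h0 hd k
      have hP : Projective W := projective_iff_hasProjectiveDimensionLT_one.2 ((hW 0).1 h)
      have hP' : Module.Projective R W := (IsProjective.iff_projective (R := R) W).2 hP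
      -- If the dimension were at most k, the k-th syzygy W would be projective and g would split.
      -- Then id - s ∘ g projects F_k onto the image of the injective map d_k, and following it by
      -- the inverse of d_k gives a forbidden retraction.
      obtain ⟨s, hs⟩ := Module.projective_lifting_property g LinearMap.id hg
      have hinj : Function.Injective (d k) := by
        rw [← LinearMap.ker_eq_bot, LinearMap.exact_iff.1 (hd k), LinearMap.range_eq_bot]
        ext x
        rw [Subsingleton.elim x 0, map_zero, map_zero]
      have hsg : ∀ w, g (s w) = w := fun w => LinearMap.congr_fun hs w
      have hmem : ∀ x, (LinearMap.id - s ∘ₗ g : F k →ₗ[R] F k) x ∈ LinearMap.range (d k) := fun x => by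
        rw [← hker]
        simp [hsg]
      refine hsplit k rfl ((LinearEquiv.ofInjective (d k) hinj).symm.toLinearMap ∘ₗ
        (LinearMap.id - s ∘ₗ g).codRestrict _ hmem) ?_
      ext x
      apply hinj
      have hz : g (d k x) = 0 := by
        rw [← LinearMap.mem_ker, hker]
        exact LinearMap.mem_range_self _ _
      simp [hz]

end ProjectiveDimension

/-! ### The differential of the co-letterplace resolution -/

namespace CoLetterplace

open MvPolynomial

/-! ### Removing elements from families of sets, and the resulting signs. -/

section Families

theorem mem_remove {P : Type*} [DecidableEq P] {n : ℕ} {K : P → Finset (Fin n)} {v : P × Fin n} {p : P} {a : Fin n} :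
    a ∈ remove K v p ↔ (p, a) ≠ v ∧ a ∈ K p := by
  obtain ⟨q, b⟩ := v
  by_cases h : p = q
  · subst h
    simp [remove]
  · simp [remove, h]
variable {P : Type*} [Fintype P] {n : ℕ}

theorem mem_OmegaBar {K : P → Finset (Fin n)} {v : P × Fin n} :
    v ∈ OmegaBar K ↔ v.2 ∈ K v.1 := by
  simp [OmegaBar]

theorem mem_Omega {K : P → Finset (Fin n)} {v : P × Fin n} :
    v ∈ Omega K ↔ 2 ≤ (K v.1).card ∧ v.2 ∈ K v.1 := by
  simp [Omega]

theorem Omega_subset (K : P → Finset (Fin n)) : Omega K ⊆ OmegaBar K := fun _ hv =>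
  mem_OmegaBar.2 (mem_Omega.1 hv).2

theorem OmegaBar_injective : Function.Injective (OmegaBar (P := P) (n := n)) := by
  intro K L h
  ext p a : 2
  rw [← mem_OmegaBar (v := (p, a)), h, mem_OmegaBar]

theorem sum_single_OmegaBar (K : P → Finset (Fin n)) :
    multidegree K = ∑ v ∈ OmegaBar K, Finsupp.single v 1 := by
  rw [OmegaBar, Finset.sum_filter, Fintype.sum_prod_type, multidegree]
  simp

theorem multidegree_apply (K : P → Finset (Fin n)) (v : P × Fin n) [Decidable (v ∈ OmegaBar K)] :
    multidegree K v = if v ∈ OmegaBar K then 1 else 0 := by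
  classical
  rw [sum_single_OmegaBar, Finsupp.finsetSum_apply]
  simp [Finsupp.single_apply]

theorem multidegree_apply_ne_zero {K : P → Finset (Fin n)} {v : P × Fin n}
    (hv : v ∈ OmegaBar K) : multidegree K v ≠ 0 := by
  classical
  simp [multidegree_apply, hv]

theorem monomialK_eq (𝕜 : Type*) [Field 𝕜] (K : P → Finset (Fin n)) :
    monomialK 𝕜 K = monomial (multidegree K) 1 := by
  simp only [monomialK, multidegree, X, monomial_sum_one]

variable [DecidableEq P]

theorem OmegaBar_remove (K : P → Finset (Fin n)) (v : P × Fin n) :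
    OmegaBar (remove K v) = (OmegaBar K).erase v := by
  ext ⟨p, a⟩
  simp [mem_OmegaBar, mem_remove]

theorem remove_comm (K : P → Finset (Fin n)) (v w : P × Fin n) :
    remove (remove K v) w = remove (remove K w) v := by
  apply OmegaBar_injective
  simp only [OmegaBar_remove]
  exact Finset.erase_right_comm

theorem multidegree_remove {K : P → Finset (Fin n)} {v : P × Fin n} (hv : v ∈ OmegaBar K) :
    Finsupp.single v 1 + multidegree (remove K v) = multidegree K := by
  rw [sum_single_OmegaBar, sum_single_OmegaBar, OmegaBar_remove]
  exact Finset.add_sum_erase _ (fun w => Finsupp.single w 1) hv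

theorem mem_Omega_of_remove {K : P → Finset (Fin n)} {v w : P × Fin n}
    (hw : w ∈ Omega (remove K v)) : w ∈ Omega K := by
  obtain ⟨h1, h2⟩ := mem_Omega.1 hw
  exact mem_Omega.2 ⟨h1.trans (Finset.card_le_card (remove_subset K v _)),
    remove_subset K v _ h2⟩

/-- Makes swapping the order of two removals an involution on the index set of d ∘ d. Within one
block, either order requires three elements. -/
theorem Omega_remove_symm {K : P → Finset (Fin n)} {v w : P × Fin n} (hv : v ∈ Omega K)
    (hw : w ∈ Omega (remove K v)) : w ≠ v ∧ w ∈ Omega K ∧ v ∈ Omega (remove K w) := by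
  have hw2 := (mem_Omega.1 hw).2
  have hne : w ≠ v := (mem_remove.1 hw2).1
  refine ⟨hne, mem_Omega_of_remove hw, mem_Omega.2 ⟨?_, mem_remove.2 ⟨hne.symm, (mem_Omega.1 hv).2⟩⟩⟩
  have hw1 := (mem_Omega.1 hw).1
  obtain ⟨p, a⟩ := v
  obtain ⟨q, b⟩ := w
  by_cases h : p = q
  · subst h
    have hb : b ∈ K p := (mem_remove.1 hw2).2
    have ha : a ∈ K p := (mem_Omega.1 hv).2
    simp only [remove, Function.update_self, Finset.card_erase_of_mem ha,
      Finset.card_erase_of_mem hb] at hw1 ⊢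
    exact hw1
  · simpa [remove, h] using (mem_Omega.1 hv).1

variable {m : ℕ} (e : Fin m ≃ P)

/-- Removing `w` from `K` lowers `σ(v)` by one precisely if `w` is larger than `v`. -/
theorem sigma_eq_remove_add {K : P → Finset (Fin n)} {v w : P × Fin n} (hw : w ∈ OmegaBar K) :
    sigma e K v = sigma e (remove K w) v +
      if e.symm w.1 < e.symm v.1 ∨ (e.symm w.1 = e.symm v.1 ∧ w.2 < v.2) then 1 else 0 := by
  simp only [sigma, OmegaBar_remove, Finset.filter_erase]
  split_ifs with h
  · exact (Finset.card_erase_add_one (Finset.mem_filter.2 ⟨hw, h⟩)).symm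
  · rw [Finset.erase_eq_of_notMem, add_zero]
    exact fun hh => h (Finset.mem_filter.1 hh).2

/-- The order on variables is total, so exactly one of v, w is larger than the other; hence the two
exponents differ by exactly one. -/
theorem sign_swap {K : P → Finset (Fin n)} {v w : P × Fin n} (hv : v ∈ OmegaBar K)
    (hw : w ∈ OmegaBar K) (h : w ≠ v) {S : Type*} [CommRing S] :
    (-1 : S) ^ (sigma e K v + sigma e (remove K v) w) =
      -(-1) ^ (sigma e K w + sigma e (remove K w) v) := by
  have h1 := sigma_eq_remove_add e (v := v) hw
  have h2 := sigma_eq_remove_add e (v := w) hv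
  have h3 : ¬ (e.symm v.1 = e.symm w.1 ∧ v.2 = w.2) := fun hh =>
    h (Prod.ext (e.symm.injective hh.1) hh.2).symm
  rw [h1, h2]
  split_ifs with h4 h5 h5
  · omega
  · ring
  · ring
  · omega

end Families

/-! ### The sequence is a complex. -/

section Differential

variable {P : Type*} [PartialOrder P] [Fintype P] {n : ℕ} {A : P → Finset (Fin n)}
  (𝕜 : Type*) [Field 𝕜] [DecidableEq P] {m : ℕ} (e : Fin m ≃ P) (𝔄 : LowerSet (HomSet A))

/-- The differential `F_{t+1} → F_t`. -/
noncomputable abbrev diff (t : ℕ) :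
    (Symbol 𝔄 (t + 1) →₀ MvPolynomial (P × Fin n) 𝕜) →ₗ[MvPolynomial (P × Fin n) 𝕜]
      (Symbol 𝔄 t →₀ MvPolynomial (P × Fin n) 𝕜) :=
  (resolution 𝕜 e 𝔄).d t

/-- The augmentation `F_0 → ℒ(𝔄)`. -/
noncomputable abbrev augm :
    (Symbol 𝔄 0 →₀ MvPolynomial (P × Fin n) 𝕜) →ₗ[MvPolynomial (P × Fin n) 𝕜] ideal 𝕜 𝔄 :=
  (resolution 𝕜 e 𝔄).aug

open Classical in
/-- The basis element `[K]`, or zero if `K` is not a symbol of degree `t`. -/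
noncomputable def symb (t : ℕ) (K : P → Finset (Fin n)) (r : MvPolynomial (P × Fin n) 𝕜) :
    Symbol 𝔄 t →₀ MvPolynomial (P × Fin n) 𝕜 :=
  if h : IsSymbol 𝔄 t K then Finsupp.single ⟨K, h⟩ r else 0

variable {𝔄}

theorem diff_apply (t : ℕ) (x : Symbol 𝔄 (t + 1) →₀ MvPolynomial (P × Fin n) 𝕜) :
    diff 𝕜 e 𝔄 t x = x.sum fun K r => ∑ v ∈ (Omega K.1).attach,
      Finsupp.single (K.remove v.1 v.2) (r * ((-1) ^ sigma e K.1 v.1 * X v.1)) := by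
  simp only [diff, resolution, Finsupp.linearCombination_apply, Finset.smul_sum,
    Finsupp.smul_single, smul_eq_mul]

theorem diff_single (t : ℕ) (K : Symbol 𝔄 (t + 1)) (r : MvPolynomial (P × Fin n) 𝕜) :
    diff 𝕜 e 𝔄 t (Finsupp.single K r) = ∑ v ∈ Omega K.1,
      symb 𝕜 𝔄 t (remove K.1 v) (r * ((-1) ^ sigma e K.1 v * X v)) := by
  rw [diff_apply, Finsupp.sum_single_index (by simp), ← Finset.sum_attach (Omega K.1)]
  refine Finset.sum_congr rfl fun v _ => ?_
  rw [symb, dif_pos (isSymbol_remove K.2 v.2)]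
  rfl

theorem diff_diff (t : ℕ) (x : Symbol 𝔄 (t + 1 + 1) →₀ MvPolynomial (P × Fin n) 𝕜) :
    diff 𝕜 e 𝔄 t (diff 𝕜 e 𝔄 (t + 1) x) = 0 := by
  induction x using Finsupp.induction_linear with
  | zero => simp
  | add x y hx hy => rw [map_add, map_add, hx, hy, add_zero]
  | single K r =>
    have h1 : ∀ v ∈ Omega K.1, diff 𝕜 e 𝔄 t
        (symb 𝕜 𝔄 (t + 1) (remove K.1 v) (r * ((-1) ^ sigma e K.1 v * X v))) =
        ∑ w ∈ Omega (remove K.1 v), symb 𝕜 𝔄 t (remove (remove K.1 v) w)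
          (r * ((-1) ^ sigma e K.1 v * X v) * ((-1) ^ sigma e (remove K.1 v) w * X w)) := by
      intro v hv
      rw [symb, dif_pos (isSymbol_remove K.2 hv), diff_single]
    rw [diff_single, map_sum, Finset.sum_congr rfl h1, Finset.sum_sigma']
    -- The terms for (v, w) and (w, v) carry the same symbol and monomial with opposite signs.
    refine Finset.sum_involution (fun z _ => ⟨z.2, z.1⟩) ?_ ?_ ?_ ?_
    · rintro ⟨v, w⟩ h
      obtain ⟨hv, hw⟩ := Finset.mem_sigma.1 h
      obtain ⟨hne, hw', hv'⟩ := Omega_remove_symm hv hw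
      have hs := sign_swap e (Omega_subset _ hv) (Omega_subset _ hw') hne
        (S := MvPolynomial (P × Fin n) 𝕜)
      have h2 : r * ((-1) ^ sigma e K.1 v * X v) * ((-1) ^ sigma e (remove K.1 v) w * X w) =
          -(r * ((-1) ^ sigma e K.1 w * X w) * ((-1) ^ sigma e (remove K.1 w) v * X v)) := by
        rw [pow_add, pow_add] at hs
        linear_combination (r * X v * X w) * hs
      dsimp only at hv hw ⊢
      rw [h2, remove_comm K.1 w v]
      unfold symb
      split_ifs
      · rw [← Finsupp.single_add, neg_add_cancel, Finsupp.single_zero]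
      · rw [add_zero]
    · rintro ⟨v, w⟩ h _
      obtain ⟨hv, hw⟩ := Finset.mem_sigma.1 h
      intro heq
      exact (Omega_remove_symm hv hw).1 (by simpa using congrArg Sigma.fst heq)
    · rintro ⟨v, w⟩ h
      obtain ⟨hv, hw⟩ := Finset.mem_sigma.1 h
      obtain ⟨hne, hw', hv'⟩ := Omega_remove_symm hv hw
      exact Finset.mem_sigma.2 ⟨hw', hv'⟩
    · rintro ⟨v, w⟩ h
      rfl

theorem augm_single (K : Symbol 𝔄 0) (r : MvPolynomial (P × Fin n) 𝕜) :
    (augm 𝕜 e 𝔄 (Finsupp.single K r) : MvPolynomial (P × Fin n) 𝕜) =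
      r * monomial (multidegree K.1) 1 := by
  simp [augm, resolution, monomialK_eq]

/-- In homological degree one, `Ω` consists of two elements `(p, a)` and `(p, b)`. -/
theorem exists_Omega_eq_pair (K : Symbol 𝔄 1) : ∃ (p : P) (a b : Fin n), a < b ∧
    K.1 p = {a, b} ∧ Omega K.1 = {(p, a), (p, b)} := by
  -- The excesses |K_p| - 1 add up to the homological degree, so exactly one block has two elements
  -- and the others are singletons.
  have hsum : ∑ p, ((K.1 p).card - 1) = 1 := by
    have h1 := K.2.card
    have h2 : ∑ p, (K.1 p).card = ∑ p, (((K.1 p).card - 1) + 1) := by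
      refine Finset.sum_congr rfl fun p _ => ?_
      have := Finset.card_pos.2 (K.2.nonempty p)
      omega
    rw [h2, Finset.sum_add_distrib] at h1
    simp at h1
    omega
  obtain ⟨p, -, hp⟩ := Finset.exists_ne_zero_of_sum_ne_zero (hsum.trans_ne one_ne_zero)
  rw [← Finset.add_sum_erase _ _ (Finset.mem_univ p)] at hsum
  have hp2 : (K.1 p).card = 2 := by omega
  have h0 : ∑ q ∈ Finset.univ.erase p, ((K.1 q).card - 1) = 0 := by omega
  rw [Finset.sum_eq_zero_iff] at h0
  obtain ⟨a, b, hab, hK⟩ : ∃ a b, a < b ∧ K.1 p = {a, b} := by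
    obtain ⟨a, b, hab, hK⟩ := Finset.card_eq_two.1 hp2
    rcases lt_or_gt_of_ne hab with h | h
    · exact ⟨a, b, h, hK⟩
    · exact ⟨b, a, h, by rw [hK, Finset.pair_comm]⟩
  refine ⟨p, a, b, hab, hK, ?_⟩
  ext ⟨q, c⟩
  rw [mem_Omega]
  by_cases hq : q = p
  · subst hq
    rw [hp2, hK]
    simp
  · have := h0 q (by simp [hq])
    simp only [Finset.mem_insert, Finset.mem_singleton, Prod.mk.injEq, hq, false_and, or_self,
      iff_false]
    omega

/-- Both faces of a degree-one symbol [K] contribute the monomial of K; their signs are opposite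
because (p, a) and (p, b) are adjacent in the order on `OmegaBar`. -/
theorem augm_diff (x : Symbol 𝔄 1 →₀ MvPolynomial (P × Fin n) 𝕜) :
    augm 𝕜 e 𝔄 (diff 𝕜 e 𝔄 0 x) = 0 := by
  induction x using Finsupp.induction_linear with
  | zero => simp
  | add x y hx hy => rw [map_add, map_add, hx, hy, add_zero]
  | single K r =>
    obtain ⟨p, a, b, hab, hK, hO⟩ := exists_Omega_eq_pair K
    have key : ∀ v ∈ Omega K.1, (augm 𝕜 e 𝔄
        (symb 𝕜 𝔄 0 (remove K.1 v) (r * ((-1) ^ sigma e K.1 v * X v))) :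
          MvPolynomial (P × Fin n) 𝕜) = (-1) ^ sigma e K.1 v * (r * monomial (multidegree K.1) 1) := by
      intro v hv
      rw [symb, dif_pos (isSymbol_remove K.2 hv), augm_single,
        ← multidegree_remove (Omega_subset _ hv), ← one_mul (1 : 𝕜), ← monomial_mul, one_mul, X]
      ring
    have hne : (p, b) ≠ (p, a) := by simp [hab.ne']
    have hva : (p, a) ∈ OmegaBar K.1 := by simp [mem_OmegaBar, hK]
    have hsign : sigma e K.1 (p, b) = sigma e K.1 (p, a) + 1 := by
      rw [sigma, sigma, ← Finset.card_insert_of_notMem (a := (p, a)) (by simp)]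
      congr 1
      ext ⟨q, c⟩
      simp only [Finset.mem_filter, Finset.mem_insert, mem_OmegaBar, Prod.mk.injEq]
      constructor
      · rintro ⟨h1, h | ⟨h, h'⟩⟩
        · exact Or.inr ⟨h1, Or.inl h⟩
        · obtain rfl := e.symm.injective h
          rw [hK, Finset.mem_insert, Finset.mem_singleton] at h1
          rcases h1 with rfl | rfl
          · exact Or.inl ⟨rfl, rfl⟩
          · exact absurd h' (lt_irrefl _)
      · rintro (⟨rfl, rfl⟩ | ⟨h1, h | ⟨h, h'⟩⟩)
        · exact ⟨by simp [hK], Or.inr ⟨rfl, hab⟩⟩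
        · exact ⟨h1, Or.inl h⟩
        · exact ⟨h1, Or.inr ⟨h, h'.trans hab⟩⟩
    apply Subtype.ext
    rw [diff_single, map_sum, Submodule.coe_sum, Finset.sum_congr rfl key, hO,
      Finset.sum_pair hne.symm, hsign, pow_succ]
    simp

end Differential

end CoLetterplace

/-! ### Exactness -/

namespace CoLetterplace

open MvPolynomial

/-! ### Coefficients of products with a signed variable. -/

section Coefficients

variable {σ : Type*} (𝕜 : Type*) [Field 𝕜]

theorem monomial_mul_sign_mul_X (w : σ →₀ ℕ) (c : 𝕜) (s : ℕ) (v : σ) :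
    monomial w c * ((-1) ^ s * X v) = monomial (w + Finsupp.single v 1) ((-1) ^ s * c) := by
  have h : ((-1) ^ s : MvPolynomial (σ) 𝕜) = C ((-1) ^ s) := by simp
  rw [h, X, C_mul_monomial, monomial_mul, mul_one, mul_comm]

variable {𝕜}

theorem exists_of_coeff_mul_sign_mul_X_ne_zero (r : MvPolynomial (σ) 𝕜) (u : σ →₀ ℕ) (s : ℕ)
    (v : σ) (h : coeff u (r * ((-1) ^ s * X v)) ≠ 0) :
    ∃ w, u = w + Finsupp.single v 1 ∧ coeff w r ≠ 0 := by
  classical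
  have hs : ((-1) ^ s : MvPolynomial (σ) 𝕜) = C ((-1) ^ s) := by simp
  rw [hs, mul_left_comm, coeff_C_mul, coeff_mul_X'] at h
  split_ifs at h with hv
  · refine ⟨u - Finsupp.single v 1, (tsub_add_cancel_of_le ?_).symm, right_ne_zero_of_mul h⟩
    exact Finsupp.single_le_iff.2 (Nat.one_le_iff_ne_zero.2 (Finsupp.mem_support_iff.1 hv))
  · simp at h

end Coefficients

/-! ### The isotone map of maxima and its rank. -/

section Top

variable {P : Type*} [PartialOrder P] [Fintype P] {n : ℕ} {A : P → Finset (Fin n)}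
  {𝔄 : LowerSet (HomSet A)} {t : ℕ}

/-- The isotone map `p ↦ max K_p` of a symbol `[K]`. -/
def Symbol.top (K : Symbol 𝔄 t) (p : P) : Fin n :=
  (K.1 p).max' (K.2.nonempty p)

theorem Symbol.top_mem (K : Symbol 𝔄 t) (p : P) : K.top p ∈ K.1 p :=
  Finset.max'_mem _ _

theorem Symbol.le_top (K : Symbol 𝔄 t) {p : P} {a : Fin n} (ha : a ∈ K.1 p) : a ≤ K.top p :=
  Finset.le_max' _ _ ha

theorem Symbol.top_le_of_lt (K : Symbol 𝔄 t) {p q : P} (h : p < q) {a : Fin n} (ha : a ∈ K.1 q) :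
    K.top p ≤ a :=
  (K.2.max_le_min p q h).trans (Finset.min'_le _ _ ha)

theorem Symbol.top_mono (K : Symbol 𝔄 t) : Monotone K.top := by
  intro p q hpq
  rcases hpq.eq_or_lt with rfl | h
  · exact le_rfl
  · exact K.top_le_of_lt h (K.top_mem q)

theorem Symbol.eq_singleton_top (K : Symbol 𝔄 0) (p : P) : K.1 p = {K.top p} := by
  have hsum : ∑ p : P, 1 = ∑ p, (K.1 p).card := by
    rw [K.2.card]
    simp
  have h := (Finset.sum_eq_sum_iff_of_le fun p _ => Finset.card_pos.2 (K.2.nonempty p)).1 hsum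
  obtain ⟨a, ha⟩ := Finset.card_eq_one.1 (h p (Finset.mem_univ p)).symm
  have := K.top_mem p
  rw [ha, Finset.mem_singleton] at this
  rw [ha, this]

/-- The sum of the values of the map `p ↦ max K_p`. -/
def Symbol.rank (K : Symbol 𝔄 t) : ℕ := ∑ p, (K.top p : ℕ)

/-- The rank is strictly monotone in the map of maxima, so it can stand in for the pointwise order
in inductions and maximality arguments. -/
theorem top_eq_of_le_of_rank_le {s : ℕ} {K : Symbol 𝔄 s} {L : Symbol 𝔄 t} (h : L.top ≤ K.top)
    (hr : K.rank ≤ L.rank) : L.top = K.top := by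
  have hle : ∀ p ∈ Finset.univ, (L.top p : ℕ) ≤ K.top p := fun p _ => h p
  have := (Finset.sum_eq_sum_iff_of_le hle).1 (le_antisymm (Finset.sum_le_sum hle) hr)
  exact funext fun p => Fin.ext (this p (Finset.mem_univ p))

section Remove

variable [DecidableEq P]

theorem top_remove_le (K : Symbol 𝔄 (t + 1)) {v : P × Fin n} (hv : v ∈ Omega K.1) :
    (K.remove v hv).top ≤ K.top := fun p =>
  K.le_top (remove_subset _ _ _ ((K.remove v hv).top_mem p))

theorem top_remove (K : Symbol 𝔄 (t + 1)) {v : P × Fin n} (hv : v ∈ Omega K.1)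
    (h : v.2 < K.top v.1) : (K.remove v hv).top = K.top := by
  refine le_antisymm (top_remove_le K hv) fun p => (K.remove v hv).le_top ?_
  refine mem_remove.2 ⟨?_, K.top_mem p⟩
  rintro rfl
  exact lt_irrefl _ h

theorem Symbol.ext_of_remove {K L : Symbol 𝔄 (t + 1)} {v : P × Fin n} (hK : v ∈ OmegaBar K.1)
    (hL : v ∈ OmegaBar L.1) (h : CoLetterplace.remove K.1 v = CoLetterplace.remove L.1 v) :
    K = L := by
  apply Subtype.ext
  apply OmegaBar_injective
  rw [← Finset.insert_erase hK, ← Finset.insert_erase hL, ← OmegaBar_remove, h, OmegaBar_remove]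

end Remove

end Top

/-! ### Addable elements and the choice of a pivot. -/

section Pivot

variable {P : Type*} [PartialOrder P] {n : ℕ}

/-- The element `v = (p, a)` can be added to every symbol `[K]` with `max K = f`: it satisfies
`a ∈ A_p`, `a < f(p)` and `f(q) ≤ a` for all `q < p`. Moreover `X_v` divides `X^u`. -/
structure IsAddable (A : P → Finset (Fin n)) (u : P × Fin n →₀ ℕ) (f : P → Fin n)
    (v : P × Fin n) : Prop where
  mem : v.2 ∈ A v.1
  lt : v.2 < f v.1
  ne_zero : u v ≠ 0
  le : ∀ q < v.1, f q ≤ v.2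

open Classical in
/-- A choice of an addable element. -/
noncomputable def pivot (A : P → Finset (Fin n)) (u : P × Fin n →₀ ℕ) (f : P → Fin n) :
    Option (P × Fin n) :=
  if h : ∃ v, IsAddable A u f v then some h.choose else none

variable {A : P → Finset (Fin n)} {u : P × Fin n →₀ ℕ} {f g : P → Fin n}

theorem isAddable_of_pivot {v : P × Fin n} (h : pivot A u f = some v) : IsAddable A u f v := by
  unfold pivot at h
  split_ifs at h with h1
  obtain rfl := Option.some.inj h
  exact h1.choose_spec

theorem exists_pivot {v : P × Fin n} (h : IsAddable A u f v) : ∃ w, pivot A u f = some w :=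
  ⟨_, dif_pos ⟨v, h⟩⟩

/-- If there is no addable element for `f`, then `f` is the least isotone map with its values in
the family of the sets `{a ∈ A_p : X_{p,a} ∣ X^u}`. -/
theorem le_of_pivot_eq_none [Finite P] (h : pivot A u f = none) (hg : Monotone g)
    (hgA : ∀ p, g p ∈ A p) (hgu : ∀ p, u (p, g p) ≠ 0) : f ≤ g := by
  by_contra hfg
  have hne : {p | g p < f p}.Nonempty := by
    by_contra hemp
    exact hfg fun p => not_lt.1 fun hp => hemp ⟨p, hp⟩
  -- At a minimal p with g(p) < f(p), the element (p, g(p)) is addable: for q < p minimality gives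
  -- f(q) ≤ g(q) ≤ g(p).
  obtain ⟨p, hp⟩ := (Set.toFinite {p | g p < f p}).exists_minimal hne
  obtain ⟨w, hw⟩ := exists_pivot (A := A) (u := u) (f := f) (v := (p, g p))
    ⟨hgA p, hp.1, hgu p, fun q hq =>
      (not_lt.1 fun hq' => hq.not_ge (hp.2 hq' hq.le)).trans (hg hq.le)⟩
  rw [h] at hw
  cases hw

end Pivot

/-! ### Collapsed chains and exactness. -/

section Exactness

variable {P : Type*} [PartialOrder P] [Fintype P] {n : ℕ} {A : P → Finset (Fin n)}
  {𝔄 : LowerSet (HomSet A)} {t : ℕ}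

/-- The term `X^w [K]` is collapsed if the pivot for its multidegree and for `max K`,
provided that there is one, belongs to `K`. -/
def IsCollapsed (w : P × Fin n →₀ ℕ) (K : Symbol 𝔄 t) : Prop :=
  ∀ v, pivot A (w + multidegree K.1) K.top = some v → v ∈ OmegaBar K.1

/-- The elements of `F_t` all of whose terms are collapsed. -/
def collapsed (𝕜 : Type*) [Field 𝕜] (𝔄 : LowerSet (HomSet A)) (t : ℕ) :
    AddSubgroup (Symbol 𝔄 t →₀ MvPolynomial (P × Fin n) 𝕜) where
  carrier := {x | ∀ K w, coeff w (x K) ≠ 0 → IsCollapsed w K}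
  zero_mem' := fun K w h => by simp at h
  add_mem' := fun {x y} hx hy K w h => by
    by_cases hxK : coeff w (x K) = 0
    · refine hy K w fun hyK => h ?_
      rw [Finsupp.add_apply, coeff_add, hxK, hyK, add_zero]
    · exact hx K w hxK
  neg_mem' := fun {x} hx K w h => hx K w fun hxK => h <| by
    rw [Finsupp.neg_apply, coeff_neg, hxK, neg_zero]

theorem single_mem_collapsed {𝕜 : Type*} [Field 𝕜] {w : P × Fin n →₀ ℕ} {K : Symbol 𝔄 t}
    (h : IsCollapsed w K) (c : 𝕜) : Finsupp.single K (monomial w c) ∈ collapsed 𝕜 𝔄 t := by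
  classical
  intro L w' hL
  rw [Finsupp.single_apply] at hL
  split_ifs at hL with hKL
  · subst hKL
    rw [coeff_monomial] at hL
    split_ifs at hL with hw
    · exact hw ▸ h
    · exact absurd rfl hL
  · exact absurd (coeff_zero _) hL

variable [DecidableEq P]

/-- An addable element can be added to a symbol. -/
theorem exists_insert (K : Symbol 𝔄 t) {u : P × Fin n →₀ ℕ} {v : P × Fin n}
    (hv : IsAddable A u K.top v) (hK : v ∉ OmegaBar K.1) :
    ∃ L : Symbol 𝔄 (t + 1), L.top = K.top ∧ v ∈ Omega L.1 ∧ remove L.1 v = K.1 := by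
  obtain ⟨p, a⟩ := v
  rw [mem_OmegaBar] at hK
  dsimp only at hK
  set L : P → Finset (Fin n) := Function.update K.1 p (insert a (K.1 p)) with hLdef
  have hmem : ∀ q b, b ∈ L q ↔ (q = p ∧ b = a) ∨ b ∈ K.1 q := by
    intro q b
    by_cases h : q = p
    · subst h
      simp [hLdef]
    · simp [hLdef, h]
  have hne : ∀ q, (L q).Nonempty := fun q =>
    (K.2.nonempty q).mono fun b hb => (hmem q b).2 (Or.inr hb)
  have htop : ∀ q, (L q).max' (hne q) = K.top q := by
    intro q
    refine le_antisymm (Finset.max'_le _ _ _ fun b hb => ?_)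
      (Finset.le_max' _ _ ((hmem _ _).2 (Or.inr (K.top_mem q))))
    rcases (hmem q b).1 hb with ⟨rfl, rfl⟩ | hb
    · exact hv.lt.le
    · exact K.le_top hb
  have hrem : remove L (p, a) = K.1 := by
    funext q
    ext b
    rw [mem_remove, hmem]
    constructor
    · rintro ⟨h1, ⟨rfl, rfl⟩ | h⟩
      · exact absurd rfl h1
      · exact h
    · intro h
      refine ⟨?_, Or.inr h⟩
      rintro heq
      obtain ⟨rfl, rfl⟩ := Prod.mk.inj heq
      exact hK h
  have hcard : (L p).card = (K.1 p).card + 1 := by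
    simp [hLdef, Finset.card_insert_of_notMem hK]
  have hL : IsSymbol 𝔄 (t + 1) L := by
    refine ⟨hne, fun q b hb => ?_, ?_, fun q r hqr => ?_, ?_⟩
    · rcases (hmem q b).1 hb with ⟨rfl, rfl⟩ | hb
      · exact hv.mem
      · exact K.2.subset q hb
    · have h1 := K.2.card
      rw [← Finset.add_sum_erase _ _ (Finset.mem_univ p)] at h1 ⊢
      have h2 : ∑ q ∈ Finset.univ.erase p, (L q).card =
          ∑ q ∈ Finset.univ.erase p, (K.1 q).card :=
        Finset.sum_congr rfl fun q hq => by simp [hLdef, Finset.ne_of_mem_erase hq]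
      rw [h2, hcard]
      omega
    -- The maxima are unchanged, so only the new element in block p must be compared with the maxima
    -- of the blocks below p.
    · rw [htop]
      refine Finset.le_min' _ _ _ fun b hb => ?_
      rcases (hmem r b).1 hb with ⟨rfl, rfl⟩ | hb
      · exact hv.le q hqr
      · exact K.top_le_of_lt hqr hb
    · obtain ⟨f, hf, hfK⟩ := K.2.max_mem
      exact ⟨f, hf, fun q => (hfK q).trans (htop q).symm⟩
  refine ⟨⟨L, hL⟩, funext htop, mem_Omega.2 ⟨?_, (hmem p a).2 (Or.inl ⟨rfl, rfl⟩)⟩, hrem⟩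
  have := Finset.card_pos.2 (K.2.nonempty p)
  dsimp only
  omega

variable (𝕜 : Type*) [Field 𝕜] {m : ℕ} (e : Fin m ≃ P)

variable {𝕜}

/-- Modulo boundaries, every element of `F_t` is a combination of collapsed terms. -/
theorem single_mem_range_sup_collapsed (K : Symbol 𝔄 t) (w : P × Fin n →₀ ℕ) (c : 𝕜) :
    Finsupp.single K (monomial w c) ∈
      (LinearMap.range (diff 𝕜 e 𝔄 t)).toAddSubgroup ⊔ collapsed 𝕜 𝔄 t := by
  -- The rank serves as termination measure: faces that are not collapsed will have a strictly
  -- smaller map of maxima.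
  induction hr : K.rank using Nat.strong_induction_on generalizing K w c with
  | _ r ih =>
  subst hr
  by_cases hK : IsCollapsed w K
  · exact AddSubgroup.mem_sup_right (single_mem_collapsed hK c)
  obtain ⟨v, hpv, hvK⟩ : ∃ v, pivot A (w + multidegree K.1) K.top = some v ∧ v ∉ OmegaBar K.1 := by
    simpa [IsCollapsed] using hK
  have hv := isAddable_of_pivot hpv
  obtain ⟨L, htop, hvL, hrem⟩ := exists_insert K hv hvK
  -- The pivot divides the total multidegree but does not lie in K, so X_v divides the coefficient
  -- monomial and can be absorbed into the symbol.
  have hwv : Finsupp.single v 1 ≤ w := by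
    have h := hv.ne_zero
    rw [Finsupp.add_apply, multidegree_apply, if_neg hvK, add_zero] at h
    exact Finsupp.single_le_iff.2 (Nat.one_le_iff_ne_zero.2 h)
  obtain ⟨w₀, rfl⟩ := exists_add_of_le hwv
  rw [add_comm _ w₀] at hpv ⊢
  set s := sigma e L.1 v
  -- The extra sign cancels the sign of the face L ∖ v = K, so the given term appears in this
  -- boundary with coefficient c.
  have hd := diff_single 𝕜 e t L (monomial w₀ ((-1) ^ s * c))
  simp only [monomial_mul_sign_mul_X] at hd
  rw [← Finset.add_sum_erase _ _ hvL, hrem, symb, dif_pos K.2, ← mul_assoc, ← mul_pow,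
    neg_one_mul, neg_neg, one_pow, one_mul, ← sub_eq_iff_eq_add] at hd
  rw [show Finsupp.single K (monomial (w₀ + Finsupp.single v 1) c) = _ from hd.symm]
  refine AddSubgroup.sub_mem _ (AddSubgroup.mem_sup_left (LinearMap.mem_range_self _ _))
    (AddSubgroup.sum_mem _ fun v' hv' => ?_)
  obtain ⟨hne, hv'L⟩ := Finset.mem_erase.1 hv'
  rw [symb, dif_pos (isSymbol_remove L.2 hv'L)]
  -- A face with unchanged maxima has the same multidegree, hence the same pivot v, and still
  -- contains it because v' ≠ v was removed: it is collapsed. Any other face has smaller rank.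
  by_cases htop' : (L.remove v' hv'L).top = K.top
  · refine AddSubgroup.mem_sup_right (single_mem_collapsed (fun v₁ hv₁ => ?_) _)
    have hdeg : w₀ + Finsupp.single v' 1 + multidegree (remove L.1 v') =
        w₀ + Finsupp.single v 1 + multidegree K.1 := by
      rw [add_assoc, multidegree_remove (Omega_subset _ hv'L), add_assoc, ← hrem,
        multidegree_remove (Omega_subset _ hvL)]
    change pivot A (w₀ + Finsupp.single v' 1 + multidegree (remove L.1 v'))
      (L.remove v' hv'L).top = _ at hv₁
    rw [hdeg, htop', hpv, Option.some_inj] at hv₁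
    subst hv₁
    rw [OmegaBar_remove]
    exact Finset.mem_erase.2 ⟨hne.symm, Omega_subset _ hvL⟩
  · refine ih _ ?_ _ _ _ rfl
    by_contra hlt
    exact htop' (top_eq_of_le_of_rank_le ((top_remove_le L hv'L).trans_eq htop) (not_lt.1 hlt))

theorem exists_sub_mem_collapsed (x : Symbol 𝔄 t →₀ MvPolynomial (P × Fin n) 𝕜) :
    ∃ z, x - diff 𝕜 e 𝔄 t z ∈ collapsed 𝕜 𝔄 t := by
  have hx : x ∈ (LinearMap.range (diff 𝕜 e 𝔄 t)).toAddSubgroup ⊔ collapsed 𝕜 𝔄 t := by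
    induction x using Finsupp.induction_linear with
    | zero => exact zero_mem _
    | add x y hx hy => exact add_mem hx hy
    | single K r =>
      induction r using MvPolynomial.induction_on' with
      | monomial w c => exact single_mem_range_sup_collapsed e K w c
      | add p q hp hq =>
        rw [Finsupp.single_add]
        exact add_mem hp hq
  obtain ⟨_, ⟨z, rfl⟩, y, hy, rfl⟩ := AddSubgroup.mem_sup.1 hx
  exact ⟨z, by rwa [add_sub_cancel_left]⟩

-- In positive degree some block has a non-maximal element, which is itself addable. Thus a
-- collapsed term of positive degree always contains a pivot that can be removed.
omit [DecidableEq P] in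
theorem exists_pivot_of_pos (K : Symbol 𝔄 (t + 1)) (w : P × Fin n →₀ ℕ) :
    ∃ v, pivot A (w + multidegree K.1) K.top = some v := by
  obtain ⟨p, hp⟩ : ∃ p, 1 < (K.1 p).card := by
    by_contra! h
    have h1 := Finset.sum_le_sum fun p (_ : p ∈ Finset.univ) => h p
    rw [K.2.card] at h1
    simp at h1
  obtain ⟨a, ha, hat⟩ := Finset.exists_mem_ne hp (K.top p)
  refine exists_pivot (v := (p, a)) ⟨K.2.subset p ha, lt_of_le_of_ne (K.le_top ha) hat, ?_,
    fun q hq => K.top_le_of_lt hq ha⟩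
  have := multidegree_apply_ne_zero (mem_OmegaBar (v := (p, a)).2 ha)
  rw [Finsupp.add_apply]
  omega

/-- The differential `F_{t+1} → F_t` is injective on combinations of collapsed terms. -/
theorem eq_zero_of_diff_eq_zero {y : Symbol 𝔄 (t + 1) →₀ MvPolynomial (P × Fin n) 𝕜}
    (hy : y ∈ collapsed 𝕜 𝔄 (t + 1)) (hd : diff 𝕜 e 𝔄 t y = 0) : y = 0 := by
  classical
  by_contra hne
  -- For L of maximal rank in the support, the face obtained by deleting the pivot v cannot cancel
  -- against any other term.
  obtain ⟨L, hL, hmax⟩ := y.support.exists_max_image Symbol.rank (Finsupp.support_nonempty_iff.2 hne)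
  obtain ⟨w, hw⟩ := MvPolynomial.ne_zero_iff.1 (Finsupp.mem_support_iff.1 hL)
  obtain ⟨v, hpv⟩ := exists_pivot_of_pos L w
  have hvL := hy L w hw v hpv
  have hv := isAddable_of_pivot hpv
  have hvO : v ∈ Omega L.1 := by
    refine mem_Omega.2 ⟨Finset.one_lt_card.2 ⟨_, mem_OmegaBar.1 hvL, _, L.top_mem v.1, hv.lt.ne⟩,
      mem_OmegaBar.1 hvL⟩
  -- Deleting v preserves the maxima of L, so a competitor K has maxima at least those of L, and
  -- equal ones by maximality of the rank. Having the same multidegree too, K has pivot v and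
  -- contains it; deleting v' ≠ v would leave v in the common face, which lacks it.
  have key : ∀ K ∈ y.support, ∀ v' (hv' : v' ∈ Omega K.1), K.remove v' hv' = L.remove v hvO →
      coeff (w + Finsupp.single v 1) (y K * ((-1) ^ sigma e K.1 v' * X v')) ≠ 0 →
      K = L ∧ v' = v := by
    intro K hK v' hv' hrem hcoeff
    obtain ⟨w', hw', hwK⟩ := exists_of_coeff_mul_sign_mul_X_ne_zero _ _ _ _ hcoeff
    have hrem' : remove K.1 v' = remove L.1 v := congrArg Subtype.val hrem
    have hdeg : w' + multidegree K.1 = w + multidegree L.1 := by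
      rw [← multidegree_remove (Omega_subset _ hv'), ← add_assoc, ← hw', hrem', add_assoc,
        multidegree_remove hvL]
    have htop : L.top = K.top := by
      refine top_eq_of_le_of_rank_le ?_ (hmax K hK)
      rw [← top_remove L hvO hv.lt, ← hrem]
      exact top_remove_le K hv'
    have hvK : v ∈ OmegaBar K.1 := hy K w' hwK v (by rw [hdeg, ← htop, hpv])
    have hvv : v' = v := by
      by_contra hvv
      have h1 : v ∈ OmegaBar (remove K.1 v') := by
        rw [OmegaBar_remove]
        exact Finset.mem_erase.2 ⟨Ne.symm hvv, hvK⟩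
      rw [hrem', OmegaBar_remove] at h1
      exact Finset.notMem_erase _ _ h1
    subst hvv
    exact ⟨Symbol.ext_of_remove hvK hvL hrem', rfl⟩
  have h0 : coeff (w + Finsupp.single v 1) (diff 𝕜 e 𝔄 t y (L.remove v hvO)) = 0 := by
    rw [hd, Finsupp.zero_apply, coeff_zero]
  rw [diff_apply, Finsupp.sum_apply, Finsupp.sum, coeff_sum, Finset.sum_eq_single L,
    Finsupp.finsetSum_apply, coeff_sum, Finset.sum_eq_single ⟨v, hvO⟩, Finsupp.single_eq_same] at h0
  · have hs : ((-1) ^ sigma e L.1 v : MvPolynomial (P × Fin n) 𝕜) = C ((-1) ^ sigma e L.1 v) := by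
      simp
    rw [hs, mul_left_comm, coeff_C_mul, coeff_mul_X] at h0
    exact (mul_ne_zero (pow_ne_zero _ (neg_ne_zero.2 one_ne_zero)) hw) h0
  · rintro ⟨v', hv'⟩ _ hvv
    rw [Finsupp.single_apply]
    split_ifs with hrem
    · by_contra hcoeff
      exact hvv (Subtype.ext (key L hL v' hv' hrem hcoeff).2)
    · exact coeff_zero _
  · exact fun h => absurd (Finset.mem_attach _ _) h
  · intro K hK hKL
    rw [Finsupp.finsetSum_apply, coeff_sum]
    refine Finset.sum_eq_zero fun v' _ => ?_
    rw [Finsupp.single_apply]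
    split_ifs with hrem
    · by_contra hcoeff
      exact hKL (key K hK v'.1 v'.2 hrem hcoeff).1
    · exact coeff_zero _
  · exact fun h => absurd hL h

-- In degree zero all blocks are singletons, while a pivot lies strictly below the maximum of its
-- block; it can never belong to K.
omit [DecidableEq P] in
theorem pivot_eq_none_of_isCollapsed {K : Symbol 𝔄 0} {w : P × Fin n →₀ ℕ}
    (h : IsCollapsed w K) : pivot A (w + multidegree K.1) K.top = none := by
  rw [Option.eq_none_iff_forall_ne_some]
  intro v hv
  have h1 := mem_OmegaBar.1 (h v hv)
  rw [K.eq_singleton_top, Finset.mem_singleton] at h1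
  exact (isAddable_of_pivot hv).lt.ne h1

-- Without a pivot, the map of maxima is least among the isotone maps compatible with the
-- multidegree, and L supplies such a map.
omit [DecidableEq P] in
theorem top_le_top_of_isCollapsed {K L : Symbol 𝔄 0} {w w' : P × Fin n →₀ ℕ}
    (h : IsCollapsed w K) (hdeg : w + multidegree K.1 = w' + multidegree L.1) :
    K.top ≤ L.top := by
  refine le_of_pivot_eq_none (pivot_eq_none_of_isCollapsed h) L.top_mono
    (fun p => L.2.subset p (L.top_mem p)) fun p => ?_
  have := multidegree_apply_ne_zero (mem_OmegaBar (v := (p, L.top p)).2 (L.top_mem p))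
  rw [hdeg, Finsupp.add_apply]
  omega

theorem augm_apply (x : Symbol 𝔄 0 →₀ MvPolynomial (P × Fin n) 𝕜) :
    (augm 𝕜 e 𝔄 x : MvPolynomial (P × Fin n) 𝕜) =
      x.sum fun K r => r * monomial (multidegree K.1) 1 := by
  conv_lhs => rw [← Finsupp.sum_single x]
  rw [Finsupp.sum, Finsupp.sum, map_sum, Submodule.coe_sum]
  simp only [augm_single]

/-- The augmentation is injective on combinations of collapsed terms. -/
theorem eq_zero_of_augm_eq_zero {y : Symbol 𝔄 0 →₀ MvPolynomial (P × Fin n) 𝕜}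
    (hy : y ∈ collapsed 𝕜 𝔄 0) (hd : augm 𝕜 e 𝔄 y = 0) : y = 0 := by
  by_contra hne
  obtain ⟨L, hL⟩ := Finsupp.support_nonempty_iff.2 hne
  obtain ⟨w, hw⟩ := MvPolynomial.ne_zero_iff.1 (Finsupp.mem_support_iff.1 hL)
  have h0 : coeff (w + multidegree L.1) (augm 𝕜 e 𝔄 y : MvPolynomial (P × Fin n) 𝕜) = 0 := by
    rw [hd, ZeroMemClass.coe_zero, coeff_zero]
  rw [augm_apply, Finsupp.sum, coeff_sum, Finset.sum_eq_single L, coeff_mul_monomial,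
    mul_one] at h0
  · exact hw h0
  · intro K hK hKL
    rw [coeff_mul_monomial']
    split_ifs with hle
    · by_contra hcoeff
      have hdeg := tsub_add_cancel_of_le hle
      have hK' := hy K _ (left_ne_zero_of_mul hcoeff)
      -- Two collapsed terms of equal multidegree both have the least map of maxima, so they have
      -- the same symbol and no cancellation can occur.
      have htop := le_antisymm (top_le_top_of_isCollapsed hK' hdeg)
        (top_le_top_of_isCollapsed (hy L w hw) hdeg.symm)
      exact hKL (Subtype.ext (funext fun p => by
        rw [K.eq_singleton_top, L.eq_singleton_top, htop]))
    · rfl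
  · exact fun h => absurd hL h

/-- A cycle minus a suitable boundary is a collapsed cycle, hence zero. -/
theorem diff_exact (t : ℕ) :
    Function.Exact (diff 𝕜 e 𝔄 (t + 1)) (diff 𝕜 e 𝔄 t) := by
  intro x
  constructor
  · intro hx
    obtain ⟨z, hz⟩ := exists_sub_mem_collapsed e x
    have := eq_zero_of_diff_eq_zero e hz (by rw [map_sub, hx, diff_diff, sub_zero])
    exact ⟨z, (sub_eq_zero.1 this).symm⟩
  · rintro ⟨z, rfl⟩
    exact diff_diff 𝕜 e t z

theorem augm_exact : Function.Exact (diff 𝕜 e 𝔄 0) (augm 𝕜 e 𝔄) := by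
  intro x
  constructor
  · intro hx
    obtain ⟨z, hz⟩ := exists_sub_mem_collapsed e x
    have := eq_zero_of_augm_eq_zero e hz (by rw [map_sub, hx, augm_diff, sub_zero])
    exact ⟨z, (sub_eq_zero.1 this).symm⟩
  · rintro ⟨z, rfl⟩
    exact augm_diff 𝕜 e z

end Exactness

end CoLetterplace

/-! ### The resolution is minimal -/

theorem map_mem_of_mem_smul_top {R M : Type*} [CommRing R] [AddCommGroup M] [Module R M]
    {I : Ideal R} (φ : M →ₗ[R] R) {x : M} (hx : x ∈ I • (⊤ : Submodule R M)) : φ x ∈ I := by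
  refine Submodule.smul_induction_on hx (fun r hr y _ => ?_) fun y z hy hz => ?_
  · rw [map_smul, smul_eq_mul]
    exact I.mul_mem_right _ hr
  · rw [map_add]
    exact I.add_mem hy hz

namespace CoLetterplace

open MvPolynomial

section Resolution

theorem monomialK_singleton {P : Type*} [Fintype P] {n : ℕ} (𝕜 : Type*) [Field 𝕜] (f : P → Fin n) :
    monomialK 𝕜 (fun p => {f p}) = monomialU 𝕜 f := by
  simp [monomialK, monomialU]

variable {P : Type*} [PartialOrder P] [Fintype P] {n : ℕ} {A : P → Finset (Fin n)}
  {𝔄 : LowerSet (HomSet A)} {t : ℕ}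

/-- A crude bound, giving finite length and the existence of the largest degree with a symbol. -/
theorem le_of_symbol (K : Symbol 𝔄 t) : t ≤ Fintype.card P * n := by
  have h1 : ∑ p, (K.1 p).card ≤ ∑ _p : P, n :=
    Finset.sum_le_sum fun p _ => (Finset.card_le_univ _).trans_eq (Fintype.card_fin n)
  rw [K.2.card] at h1
  simp at h1
  omega

theorem isSymbol_singleton {f : HomSet A} (hf : f ∈ 𝔄) : IsSymbol 𝔄 0 fun p => {f.1 p} where
  nonempty p := Finset.singleton_nonempty _
  subset p := Finset.singleton_subset_iff.2 (f.2.2 p)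
  card := by simp
  max_le_min p q h := by simpa using f.2.1 h.le
  max_mem := ⟨f, hf, fun p => by simp⟩

variable (𝕜 : Type*) [Field 𝕜]

/-- Needed when p = 0: the zero module has projective dimension ⊥ rather than 0. -/
theorem ideal_ne_bot {f : HomSet A} (hf : f ∈ 𝔄) : ideal 𝕜 𝔄 ≠ ⊥ := by
  intro h
  have h1 : monomialU 𝕜 f.1 ∈ ideal 𝕜 𝔄 := Ideal.subset_span ⟨f, hf, rfl⟩
  rw [h, Ideal.mem_bot, monomialU, Finset.prod_eq_zero_iff] at h1
  obtain ⟨p, -, hp⟩ := h1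
  exact X_ne_zero _ hp

variable [DecidableEq P] {m : ℕ} (e : Fin m ≃ P)

theorem augm_surjective : Function.Surjective (augm 𝕜 e 𝔄) := by
  have key : ideal 𝕜 𝔄 ≤ Submodule.map (Submodule.subtype _) (LinearMap.range (augm 𝕜 e 𝔄)) := by
    refine Ideal.span_le.2 ?_
    rintro _ ⟨f, hf, rfl⟩
    refine ⟨_, ⟨Finsupp.single ⟨_, isSymbol_singleton hf⟩ 1, rfl⟩, ?_⟩
    rw [Submodule.subtype_apply, augm_single, one_mul, ← monomialK_eq, monomialK_singleton]
  intro y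
  obtain ⟨_, ⟨x, rfl⟩, hx⟩ := key y.2
  exact ⟨x, Subtype.ext hx⟩

theorem diff_homogeneous (u : P × Fin n →₀ ℕ)
    (x : Symbol 𝔄 (t + 1) →₀ MvPolynomial (P × Fin n) 𝕜)
    (hx : ∀ K, ∀ w ∈ (x K).support, w + multidegree K.1 = u) :
    ∀ L, ∀ w ∈ (diff 𝕜 e 𝔄 t x L).support, w + multidegree L.1 = u := by
  classical
  intro L w hw
  rw [mem_support_iff, diff_apply, Finsupp.sum_apply, Finsupp.sum, coeff_sum] at hw
  obtain ⟨K, -, hK⟩ := Finset.exists_ne_zero_of_sum_ne_zero hw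
  rw [Finsupp.finsetSum_apply, coeff_sum] at hK
  obtain ⟨v, -, hv⟩ := Finset.exists_ne_zero_of_sum_ne_zero hK
  rw [Finsupp.single_apply] at hv
  split_ifs at hv with hL
  · obtain ⟨w', rfl, hw'⟩ := exists_of_coeff_mul_sign_mul_X_ne_zero _ _ _ _ hv
    rw [← hx K w' (mem_support_iff.2 hw')]
    rw [← multidegree_remove (Omega_subset _ v.2), ← hL, add_assoc]
    rfl
  · exact absurd (coeff_zero _) hv

theorem augm_homogeneous (u : P × Fin n →₀ ℕ) (x : Symbol 𝔄 0 →₀ MvPolynomial (P × Fin n) 𝕜)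
    (hx : ∀ K, ∀ w ∈ (x K).support, w + multidegree K.1 = u) :
    ∀ w ∈ (augm 𝕜 e 𝔄 x : MvPolynomial (P × Fin n) 𝕜).support, w = u := by
  intro w hw
  rw [mem_support_iff, augm_apply, Finsupp.sum, coeff_sum] at hw
  obtain ⟨K, -, hK⟩ := Finset.exists_ne_zero_of_sum_ne_zero hw
  rw [coeff_mul_monomial'] at hK
  split_ifs at hK with hle
  · rw [← hx K _ (mem_support_iff.2 (left_ne_zero_of_mul hK))]
    exact (tsub_add_cancel_of_le hle).symm
  · exact absurd rfl hK

theorem isMultigradedFreeResolution : (resolution 𝕜 e 𝔄).IsMultigradedFreeResolution where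
  finite _ := inferInstanceAs (Finite (Symbol 𝔄 _))
  bounded := ⟨Fintype.card P * n, fun _ ht => ⟨fun K => ht.not_ge (le_of_symbol K)⟩⟩
  aug_surjective := augm_surjective 𝕜 e
  exact_zero := augm_exact e
  exact_succ := diff_exact e
  d_homogeneous _ := diff_homogeneous 𝕜 e
  aug_homogeneous := augm_homogeneous 𝕜 e

theorem diff_mem (x : Symbol 𝔄 (t + 1) →₀ MvPolynomial (P × Fin n) 𝕜) :
    diff 𝕜 e 𝔄 t x ∈ Ideal.span (Set.range (X : P × Fin n → MvPolynomial (P × Fin n) 𝕜)) •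
      (⊤ : Submodule (MvPolynomial (P × Fin n) 𝕜)
        (Symbol 𝔄 t →₀ MvPolynomial (P × Fin n) 𝕜)) := by
  rw [diff_apply]
  refine Submodule.sum_mem _ fun K _ => Submodule.sum_mem _ fun v _ => ?_
  rw [← mul_one (_ * _), ← smul_eq_mul, ← Finsupp.smul_single]
  refine Submodule.smul_mem_smul ?_ Submodule.mem_top
  exact Ideal.mul_mem_left _ _ (Ideal.mul_mem_left _ _ (Ideal.subset_span ⟨_, rfl⟩))

theorem isMinimal : (resolution 𝕜 e 𝔄).IsMinimal := by
  rintro t _ ⟨x, rfl⟩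
  exact diff_mem 𝕜 e x

/-- A differential of the resolution whose source is not zero has no left inverse. -/
theorem comp_diff_ne_id (K : Symbol 𝔄 (t + 1))
    (r : (Symbol 𝔄 t →₀ MvPolynomial (P × Fin n) 𝕜) →ₗ[MvPolynomial (P × Fin n) 𝕜]
      (Symbol 𝔄 (t + 1) →₀ MvPolynomial (P × Fin n) 𝕜)) :
    r ∘ₗ diff 𝕜 e 𝔄 t ≠ LinearMap.id := by
  intro h
  set 𝔪 : Ideal (MvPolynomial (P × Fin n) 𝕜) := Ideal.span (Set.range X)
  -- With a left inverse r, the K-coordinate of r(d[K]) is 1; by minimality it lies in 𝔪, whose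
  -- elements have zero constant coefficient.
  let φ := Finsupp.lapply (R := MvPolynomial (P × Fin n) 𝕜) K ∘ₗ r
  have h1 : φ (diff 𝕜 e 𝔄 t (Finsupp.single K 1)) = 1 := by
    change (r ∘ₗ diff 𝕜 e 𝔄 t) (Finsupp.single K 1) K = 1
    rw [h, LinearMap.id_apply, Finsupp.single_eq_same]
  have h2 : φ (diff 𝕜 e 𝔄 t (Finsupp.single K 1)) ∈ 𝔪 :=
    map_mem_of_mem_smul_top φ (diff_mem 𝕜 e _)
  rw [h1] at h2
  have h4 : 𝔪 ≤ RingHom.ker (constantCoeff (R := 𝕜) (σ := P × Fin n)) := by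
    refine Ideal.span_le.2 ?_
    rintro _ ⟨v, rfl⟩
    simp [RingHom.mem_ker]
  simpa using h4 h2

end Resolution

end CoLetterplace

/-! ### The main theorem. -/

theorem theorem4p4 {𝕜 : Type*} [Field 𝕜] {P : Type*} [PartialOrder P] [Fintype P] [DecidableEq P]
    {n m : ℕ} (e : Fin m ≃ P) (he : ∀ i j, e i < e j → i < j)
    (A : P → Finset (Fin n)) (hA : ∀ p, (A p).Nonempty)
    (𝔄 : LowerSet (CoLetterplace.HomSet A)) (h𝔄 : (𝔄 : Set (CoLetterplace.HomSet A)).Nonempty) :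
    (CoLetterplace.resolution 𝕜 e 𝔄).IsMultigradedFreeResolution ∧
    (CoLetterplace.resolution 𝕜 e 𝔄).IsMinimal ∧
    ∃ p : ℕ, IsGreatest {t : ℕ | Nonempty (CoLetterplace.Symbol 𝔄 t)} p ∧
      CategoryTheory.projectiveDimension
        (ModuleCat.of (MvPolynomial (P × Fin n) 𝕜) (CoLetterplace.ideal 𝕜 𝔄)) = (p : ℕ∞) := by
  refine ⟨CoLetterplace.isMultigradedFreeResolution 𝕜 e, CoLetterplace.isMinimal 𝕜 e, ?_⟩
  obtain ⟨f, hf⟩ := h𝔄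
  have hne : {t : ℕ | Nonempty (CoLetterplace.Symbol 𝔄 t)}.Nonempty :=
    ⟨0, ⟨⟨_, CoLetterplace.isSymbol_singleton hf⟩⟩⟩
  have hbdd : BddAbove {t : ℕ | Nonempty (CoLetterplace.Symbol 𝔄 t)} :=
    ⟨Fintype.card P * n, fun t ⟨K⟩ => CoLetterplace.le_of_symbol K⟩
  obtain ⟨p, hp⟩ := hbdd.exists_isGreatest_of_nonempty hne
  refine ⟨p, hp, ?_⟩
  have hemp : IsEmpty (CoLetterplace.Symbol 𝔄 (p + 1)) :=
    ⟨fun K => (Nat.lt_succ_self p).not_ge (hp.2 ⟨K⟩)⟩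
  refine projectiveDimension_eq_of_resolution
    (F := fun t => CoLetterplace.Symbol 𝔄 t →₀ MvPolynomial (P × Fin n) 𝕜)
    (CoLetterplace.augm_surjective 𝕜 e) (CoLetterplace.augm_exact e) (CoLetterplace.diff_exact e)
    p inferInstance (Submodule.nontrivial_iff_ne_bot.2 (CoLetterplace.ideal_ne_bot 𝕜 hf)) ?_
  rintro k rfl r
  obtain ⟨K⟩ := hp.1
  exact CoLetterplace.comp_diff_ne_id 𝕜 e K r
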